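/- **Setting.** Let $N=N_1+\dots+N_n$ and let $A=[A_1,\dots,A_n]\in\mathbb{R}^{m\times N}$ have nonzero column blocks $A_i\in\mathbb{R}^{m\times N_i}$. For $x\in\mathbb{R}^N$ let $x^{(i)}\in\mathbb{R}^{N_i}$ be its $i$-th block, and for $S\subseteq[n]=\{1,\dots,n\}$ let $h_{[S]}$ be the vector obtained from $h\in\mathbb{R}^N$ by zeroing out the blocks outside $S$. Let $A_{ji}$ be the $j$-th row of $A_i$. Let $B_i\in\mathbb{R}^{N_i\times N_i}$ be symmetric positive definite, $v_1,\dots,v_m>0$, and for $p\in\{1,2\}$ put $$\|z\|_v=\Big(\sum_{j=1}^m v_j^p|z_j|^p\Big)^{1/p},\qquad \|z\|_v^*=\max_{\|z'\|_v\le 1}\langle z',z\rangle ,\qquad z\in\mathbb{R}^m .$$ Let $f(x)=\max_{z\in Q}\{\langle Ax,z\rangle-g(z)\}$, where $Q\subseteq\mathbb{R}^m$ is nonempty, compact and convex and $g:\mathbb{R}^m\to\mathbb{R}$ is convex, and suppose that $f$ is *Nesterov separable of degree* $\omega\in\mathbb{N}$, i.e. $\max_{1\le j\le m}|\{i : A_{ji}\ne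 0\}|\le\omega$. Let $d:\mathbb{R}^m\to\mathbb{R}$ be $\sigma$-strongly convex on $Q$ with respect to $\|\cdot\|_v$ ($\sigma>0$), nonnegative on $Q$, with $d(z_0)=0$ for some $z_0\in Q$, and for $\mu>0$ let $$f_\mu(x)=\sup_{z\in Q}\{\langle Ax,z\rangle-g(z)-\mu d(z)\}$$ (a maximum if $d$ is continuous on $Q$). Define weights $w^*=(w_1^*,\dots,w_n^*)$ by $$w_i^*=\max\{(\|A_iB_i^{-1/2}t\|_v^*)^2 : t\in\mathbb{R}^{N_i},\ \textstyle\sum_k t_k^2=1\}.$$ Let $\hat S$ be a $\tau$-nice sampling with $\tau\ge1$: a random subset of $[n]$ with $|\hat S|=\tau$ almost surely, all subsets of cardinality $\tau$ being equally likely. A differentiable function $\phi:\mathbb{R}^N\to\mathbb{R}$ *admits a $(\beta,w)$-ESO with respect to* $\hat S$, where $\beta>0$ and $w\in\mathbb{R}^n$ has positive entries, if for all $x,h\in\mathbb{R}^N$ $$\mathbf{E}\big[\phi(x+h_{[\hat S]})\big]\le\phi(x)+\frac{\mathbf{E}[|\hat S|]}{n}\Big(\langle\nabla\phi(x),h\rangle+\frac{\beta}{2}\sum_{i=1}^n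 w_i\langle B_ih^{(i)},h^{(i)}\rangle\Big).$$ **Theorem.** In this setting $f_\mu$ is differentiable, $w_i^*>0$ for all $i$, and $f_\mu$ admits a $\big(\tfrac{\beta'}{\mu\sigma},w^*\big)$-ESO with respect to $\hat S$, where $\beta'>0$ is given as follows. * If $p=2$: $$\beta'=1+\frac{(\omega-1)(\tau-1)}{\max(1,n-1)}.$$ * If $p=1$ and $\omega\le n$: $$\beta'=\sum_{k=1}^{k_{\max}}\min\Big\{1,\ \frac{mn}{\tau}\sum_{l=\max\{k,k_{\min}\}}^{k_{\max}}c_l\,\pi_l\Big\},$$ where $k_{\min}=\max\{1,\tau-(n-\omega)\}$, $k_{\max}=\min\{\tau,\omega\}$, $\pi_l=\binom{\omega}{l}\binom{n-\omega}{\tau-l}\big/\binom{n}{\tau}$, and $c_l=\max\{\tfrac{l}{\omega},\tfrac{\tau-l}{n-\omega}\}$ if $\omega<n$, $c_l=\tfrac{l}{\omega}$ if $\omega=n$. -/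

import Mathlib

open MeasureTheory Matrix
open scoped MatrixOrder

noncomputable section

namespace NesterovESO

/-- `ℝ^N` with `N = N₁ + ⋯ + Nₙ`: coordinates are indexed by pairs
(block `i`, position inside block `i`), and the norm is the Euclidean one. -/
abbrev BlockSpace {n : ℕ} (N : Fin n → ℕ) : Type :=
  EuclideanSpace ℝ (Σ i : Fin n, Fin (N i))

variable {m n : ℕ} {N : Fin n → ℕ}

/-- The `i`-th block `x^(i) ∈ ℝ^{N_i}` of `x ∈ ℝ^N`. -/
def block (x : BlockSpace N) (i : Fin n) : Fin (N i) → ℝ := fun k => x ⟨i, k⟩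

/-- The vector `h_[S]`: blocks of `h` outside `S` are zeroed out. -/
def restrictBlocks (h : BlockSpace N) (S : Finset (Fin n)) : BlockSpace N :=
  WithLp.toLp 2 fun c => if c.1 ∈ S then h c else 0

/-- The column submatrix `A_i ∈ ℝ^{m × N_i}` of `A`. -/
def colBlock (A : Matrix (Fin m) (Σ i : Fin n, Fin (N i)) ℝ) (i : Fin n) :
    Matrix (Fin m) (Fin (N i)) ℝ :=
  A.submatrix id fun k => ⟨i, k⟩

/-- `Ω(Aᵀ e_j)`: the set of blocks `i` in which the `j`-th row of `A` does not vanish. -/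
def rowBlocks (A : Matrix (Fin m) (Σ i : Fin n, Fin (N i)) ℝ) (j : Fin m) : Set (Fin n) :=
  {i | colBlock A i j ≠ 0}

/-- The weighted `p`-norm `‖z‖_v = (∑ v_j^p |z_j|^p)^{1/p}`. -/
def vNorm (p : ℝ) (v : Fin m → ℝ) (z : Fin m → ℝ) : ℝ :=
  (∑ j, v j ^ p * |z j| ^ p) ^ (1 / p)

/-- The conjugate norm `‖z‖_v^* = max {⟨z', z⟩ : ‖z'‖_v ≤ 1}`. -/
def vDualNorm (p : ℝ) (v : Fin m → ℝ) (z : Fin m → ℝ) : ℝ :=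
  sSup ((fun z' : Fin m → ℝ => z' ⬝ᵥ z) '' {z' | vNorm p v z' ≤ 1})

/-- `d` is `σ`-strongly convex on the (convex) set `Q` with respect to `‖·‖_v`. -/
def StronglyConvexOn (p : ℝ) (v : Fin m → ℝ) (Q : Set (Fin m → ℝ)) (σ : ℝ)
    (d : (Fin m → ℝ) → ℝ) : Prop :=
  ∀ z₁ ∈ Q, ∀ z₂ ∈ Q, ∀ t : ℝ, 0 ≤ t → t ≤ 1 →
    d (t • z₁ + (1 - t) • z₂) ≤
      t * d z₁ + (1 - t) * d z₂ - σ / 2 * t * (1 - t) * vNorm p v (z₁ - z₂) ^ 2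

/-- `d` is a prox function on `Q` with parameter `σ`: it is `σ`-strongly convex on `Q`
with respect to `‖·‖_v`, nonnegative on `Q`, and vanishes at some point of `Q`. -/
def IsProxFunction (p : ℝ) (v : Fin m → ℝ) (Q : Set (Fin m → ℝ)) (σ : ℝ)
    (d : (Fin m → ℝ) → ℝ) : Prop :=
  StronglyConvexOn p v Q σ d ∧ (∀ z ∈ Q, 0 ≤ d z) ∧ ∃ z₀ ∈ Q, d z₀ = 0

/-- `f` has the form `f(x) = max_{z ∈ Q} {⟨Ax, z⟩ - g(z)}` with `Q` nonempty, compact and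
convex and `g` convex, and every row of `A` has at most `ω` nonzero blocks:
`f` is Nesterov (block) separable of degree `ω`, with representation `(A, Q, g)`. -/
def IsNesterovSeparable (A : Matrix (Fin m) (Σ i : Fin n, Fin (N i)) ℝ)
    (Q : Set (Fin m → ℝ)) (g : (Fin m → ℝ) → ℝ) (ω : ℕ) (f : BlockSpace N → ℝ) : Prop :=
  Q.Nonempty ∧ IsCompact Q ∧ Convex ℝ Q ∧ ConvexOn ℝ Set.univ g ∧
  (∀ x, f x = sSup ((fun z : Fin m → ℝ => (A *ᵥ x.ofLp) ⬝ᵥ z - g z) '' Q)) ∧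
  ∀ j, (rowBlocks A j).ncard ≤ ω

/-- `f_μ(x) = max_{z ∈ Q} {⟨Ax, z⟩ - g(z) - μ d(z)}`. -/
def smoothed (A : Matrix (Fin m) (Σ i : Fin n, Fin (N i)) ℝ)
    (Q : Set (Fin m → ℝ)) (g d : (Fin m → ℝ) → ℝ) (μ : ℝ) (x : BlockSpace N) : ℝ :=
  sSup ((fun z : Fin m → ℝ => (A *ᵥ x.ofLp) ⬝ᵥ z - g z - μ * d z) '' Q)

/-- The weights `w_i^* = max {(‖A_i B_i^{-1/2} t‖_v^*)² : t ∈ ℝ^{N_i}, ‖t‖ = 1}`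
(Euclidean norm of `t`). -/
def wStar (p : ℝ) (v : Fin m → ℝ) (A : Matrix (Fin m) (Σ i : Fin n, Fin (N i)) ℝ)
    (B : (i : Fin n) → Matrix (Fin (N i)) (Fin (N i)) ℝ) (i : Fin n) : ℝ :=
  sSup ((fun t : EuclideanSpace ℝ (Fin (N i)) =>
      vDualNorm p v (colBlock A i *ᵥ ((CFC.sqrt (B i))⁻¹ *ᵥ t.ofLp)) ^ 2) '' {t | ‖t‖ = 1})

section Sampling

variable {Om : Type*} [MeasurableSpace Om]

/-- A (block) sampling: a random subset of `[n]`. -/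
def IsSampling (S : Om → Finset (Fin n)) : Prop :=
  ∀ T : Finset (Fin n), MeasurableSet (S ⁻¹' {T})

/-- A uniform sampling: all blocks are chosen with the same probability. -/
def IsUniformSampling (P : Measure Om) (S : Om → Finset (Fin n)) : Prop :=
  IsSampling S ∧ ∀ i j : Fin n, P {s | i ∈ S s} = P {s | j ∈ S s}

/-- A `τ`-uniform sampling. -/
def IsTauUniform (P : Measure Om) (τ : ℕ) (S : Om → Finset (Fin n)) : Prop :=
  IsUniformSampling P S ∧ P {s | (S s).card = τ} = 1

/-- A `τ`-nice sampling: `τ`-uniform, and all subsets of `[n]` of cardinality `τ` are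
equally likely. -/
def IsTauNice (P : Measure Om) (τ : ℕ) (S : Om → Finset (Fin n)) : Prop :=
  IsTauUniform P τ S ∧ ∀ T₁ T₂ : Finset (Fin n), T₁.card = τ → T₂.card = τ →
    P {s | S s = T₁} = P {s | S s = T₂}

/-- `(φ, Ŝ) ∼ ESO(β, w)`: the function `φ` is differentiable, `β > 0`, `w > 0` and
`E[φ(x + h_[Ŝ])] ≤ φ(x) + E|Ŝ|/n * (⟨∇φ(x), h⟩ + β/2 * ∑ w_i ⟨B_i h^(i), h^(i)⟩)`
for all `x, h`. -/
def AdmitsESO (P : Measure Om) (S : Om → Finset (Fin n))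
    (B : (i : Fin n) → Matrix (Fin (N i)) (Fin (N i)) ℝ)
    (φ : BlockSpace N → ℝ) (β : ℝ) (w : Fin n → ℝ) : Prop :=
  Differentiable ℝ φ ∧ 0 < β ∧ (∀ i, 0 < w i) ∧
  ∀ x h : BlockSpace N,
    ∫ s, φ (x + restrictBlocks h (S s)) ∂P ≤
      φ x + (∫ s, ((S s).card : ℝ) ∂P) / n *
        (inner ℝ (gradient φ x) h + β / 2 * ∑ i, w i * ((B i *ᵥ block h i) ⬝ᵥ block h i))

end Sampling

/-- `β'₂ = 1 + (ω - 1)(τ - 1) / max(1, n - 1)`. -/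
def betaTwo (n ω τ : ℕ) : ℝ :=
  1 + ((ω : ℝ) - 1) * ((τ : ℝ) - 1) / max 1 ((n : ℝ) - 1)

/-- `k_min = max {1, τ - (n - ω)}` (for `ω ≤ n`; truncation at `0` is harmless here). -/
def kMin (n ω τ : ℕ) : ℕ := max 1 (τ - (n - ω))

/-- `k_max = min {τ, ω}`. -/
def kMax (ω τ : ℕ) : ℕ := min τ ω

/-- `c_l = max {l / ω, (τ - l) / (n - ω)}` if `ω < n`, and `c_l = l / ω` otherwise. -/
def cCoef (n ω τ l : ℕ) : ℝ :=
  if ω < n then max ((l : ℝ) / ω) (((τ : ℝ) - l) / ((n : ℝ) - ω)) else (l : ℝ) / ω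

/-- The hypergeometric probability `π_l = C(ω, l) C(n - ω, τ - l) / C(n, τ)`; it is used
only for `ω ≤ n` and `l ≤ τ ≤ n`. -/
def piProb (n ω τ l : ℕ) : ℝ :=
  (ω.choose l : ℝ) * ((n - ω).choose (τ - l) : ℝ) / (n.choose τ : ℝ)

/-- `β'₃ = ∑_{k=1}^{k_max} min {1, (m n / τ) ∑_{l = max(k, k_min)}^{k_max} c_l π_l}`. -/
def betaThree (m n ω τ : ℕ) : ℝ :=
  ∑ k ∈ Finset.Icc 1 (kMax ω τ),
    min 1 (((m : ℝ) * n / τ) *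
      ∑ l ∈ Finset.Icc (max k (kMin n ω τ)) (kMax ω τ), cCoef n ω τ l * piProb n ω τ l)

end NesterovESO

end

/-! The function `smoothed` is the conjugate of `g + μ d` on `Q`, which is `μσ`-strongly convex.
Hence it has a gradient `y` at every `x`, with `f_μ(x + h) ≤ f_μ(x) + ⟨y, h⟩ + (‖Ah‖_v^*)² / (2μσ)`
(`exists_conjugate_quadratic_bound`, `exists_gradient_smoothed`). Put `h_[T]` for `h` and average
over all `T` of size `τ`: the linear term becomes `(τ/n)⟨y, h⟩`, and `‖A_i h^(i)‖_v^*² ≤ w_i^* ⟨B_i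
h^(i), h^(i)⟩`. What remains is the second moment bound `E ‖∑_{i ∈ Ŝ} A_i h^(i)‖_v^*² ≤ (τ/n) β' ∑
‖A_i h^(i)‖_v^*²` (`admitsESO_of_moment_bound`).

For `p = 2` the dual norm is weighted Euclidean, so rows decouple; each row is a pair count plus
Cauchy-Schwarz on at most `ω` nonzero entries (`sum_sq_sum_le_betaTwo`).

For `p = 1` the dual norm is a weighted maximum, attained at a row `j` depending on `T`.
Cauchy-Schwarz leaves `|T ∩ R_j| ∑_{T ∩ R_j} q_i`, where `R_j` is the row support and `q_i = ‖A_i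
h^(i)‖_v^*²`. Writing `|T ∩ R_j|` as a sum over `k` of indicators of `k ≤ |T ∩ R_j|`, each layer is
bounded either by dropping the indicator or by a union bound over rows with a hypergeometric count;
this gives the `min` in `betaThree` (`sum_le_betaThree`). -/

namespace NesterovESO

/-! ### Dual norms as norms of linear images. -/

/-- Entrywise division by the weights `v`, valued in `ℝ^m` with the sup norm. -/
noncomputable def divSup {m : ℕ} (v : Fin m → ℝ) : (Fin m → ℝ) →ₗ[ℝ] (Fin m → ℝ) where
  toFun z := fun j => z j / v j
  map_add' x y := by ext j; simp [add_div]
  map_smul' c x := by ext j; simp [mul_div_assoc]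

/-- Entrywise division by the weights `v`, valued in `ℝ^m` with the Euclidean norm. -/
noncomputable def divEuclid {m : ℕ} (v : Fin m → ℝ) : (Fin m → ℝ) →ₗ[ℝ] EuclideanSpace ℝ (Fin m) where
  toFun z := WithLp.toLp 2 fun j => z j / v j
  map_add' x y := by ext j; simp [add_div]
  map_smul' c x := by ext j; simp [mul_div_assoc]

lemma divSup_injective {m : ℕ} {v : Fin m → ℝ} (hv : ∀ j, 0 < v j) :
    Function.Injective (divSup v) := by
  intro x y h
  ext j
  have := congrFun h j
  simpa [divSup, div_left_inj' (hv j).ne'] using this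

lemma divEuclid_injective {m : ℕ} {v : Fin m → ℝ} (hv : ∀ j, 0 < v j) :
    Function.Injective (divEuclid v) := by
  intro x y h
  ext j
  have := congrArg (fun z : EuclideanSpace ℝ (Fin m) => z j) h
  simpa [divEuclid, div_left_inj' (hv j).ne'] using this

lemma vNorm_one {m : ℕ} (v z : Fin m → ℝ) : vNorm 1 v z = ∑ j, v j * |z j| := by
  simp [vNorm]

lemma vNorm_two {m : ℕ} (v z : Fin m → ℝ) : vNorm 2 v z = √(∑ j, (v j * z j) ^ 2) := by
  simp [vNorm, Real.sqrt_eq_rpow, mul_pow]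

lemma norm_divEuclid {m : ℕ} (v z : Fin m → ℝ) :
    ‖divEuclid v z‖ = √(∑ j, (z j / v j) ^ 2) := by
  simp [divEuclid, EuclideanSpace.norm_eq, -Real.norm_eq_abs, -norm_div, Real.norm_eq_abs, sq_abs]

lemma dotProduct_le_vNorm_one {m : ℕ} {v : Fin m → ℝ} (hv : ∀ j, 0 < v j) (z u : Fin m → ℝ) :
    z ⬝ᵥ u ≤ vNorm 1 v z * ‖divSup v u‖ := by
  rw [vNorm_one, dotProduct, Finset.sum_mul]
  refine Finset.sum_le_sum fun j _ => ?_
  have h := norm_le_pi_norm (divSup v u) j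
  have hj := hv j
  calc z j * u j ≤ |z j * u j| := le_abs_self _
    _ = v j * |z j| * ‖divSup v u j‖ := by
      simp only [divSup, LinearMap.coe_mk, AddHom.coe_mk, Real.norm_eq_abs, abs_div, abs_mul,
        abs_of_pos hj]
      field_simp
    _ ≤ _ := by gcongr

lemma dotProduct_le_vNorm_two {m : ℕ} {v : Fin m → ℝ} (hv : ∀ j, 0 < v j) (z u : Fin m → ℝ) :
    z ⬝ᵥ u ≤ vNorm 2 v z * ‖divEuclid v u‖ := by
  rw [vNorm_two, norm_divEuclid]
  refine le_trans (le_of_eq ?_) (Real.sum_mul_le_sqrt_mul_sqrt _ _ _)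
  refine Finset.sum_congr rfl fun j _ => ?_
  have hj := (hv j).ne'
  field_simp

lemma vDualNorm_eq_of_isGreatest {m : ℕ} {p : ℝ} {v u : Fin m → ℝ} {r : ℝ} (hr : 0 ≤ r)
    (hle : ∀ z, z ⬝ᵥ u ≤ vNorm p v z * r) (hex : ∃ z, vNorm p v z ≤ 1 ∧ z ⬝ᵥ u = r) :
    vDualNorm p v u = r := by
  obtain ⟨z, hz, hzu⟩ := hex
  refine IsGreatest.csSup_eq ⟨⟨z, hz, hzu⟩, ?_⟩
  rintro _ ⟨z', hz', rfl⟩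
  exact (hle z').trans (mul_le_of_le_one_left hr hz')

lemma exists_norm_divSup_eq {m : ℕ} [Nonempty (Fin m)] (v u : Fin m → ℝ) :
    ∃ j, ‖divSup v u‖ = ‖divSup v u j‖ := by
  obtain ⟨j, -, hj⟩ := Finset.exists_mem_eq_sup' Finset.univ_nonempty (fun j => ‖divSup v u j‖)
  refine ⟨j, le_antisymm ?_ (norm_le_pi_norm _ j)⟩
  refine (pi_norm_le_iff_of_nonneg (norm_nonneg _)).2 fun i => ?_
  rw [← hj]
  exact Finset.le_sup' (fun j => ‖divSup v u j‖) (Finset.mem_univ i)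

lemma vDualNorm_one {m : ℕ} {v : Fin m → ℝ} (hv : ∀ j, 0 < v j) (u : Fin m → ℝ) :
    vDualNorm 1 v u = ‖divSup v u‖ := by
  refine vDualNorm_eq_of_isGreatest (norm_nonneg _)
    (fun z => dotProduct_le_vNorm_one hv z u) ?_
  rcases isEmpty_or_nonempty (Fin m) with hm | hm
  · exact ⟨0, by simp [vNorm_one], by simp [Subsingleton.elim (divSup v u) 0]⟩
  · obtain ⟨j, hn⟩ := exists_norm_divSup_eq v u
    have hvj := hv j
    -- All mass sits on a row where `|u_j| / v_j` is maximal.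
    refine ⟨Pi.single j (SignType.sign (u j) / v j), ?_, ?_⟩
    · rw [vNorm_one, Finset.sum_eq_single j]
      · rw [Pi.single_eq_same, abs_div, abs_of_pos hvj, mul_div_cancel₀ _ hvj.ne']
        rcases lt_trichotomy (u j) 0 with h | h | h <;> simp [h]
      · intro i _ hi
        simp [Pi.single_eq_of_ne hi]
      · simp
    · rw [hn, single_dotProduct]
      simp only [divSup, LinearMap.coe_mk, AddHom.coe_mk, Real.norm_eq_abs, abs_div,
        abs_of_pos hvj]
      rw [div_mul_eq_mul_div, sign_mul_self]

lemma vDualNorm_two {m : ℕ} {v : Fin m → ℝ} (hv : ∀ j, 0 < v j) (u : Fin m → ℝ) :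
    vDualNorm 2 v u = ‖divEuclid v u‖ := by
  refine vDualNorm_eq_of_isGreatest (norm_nonneg _)
    (fun z => dotProduct_le_vNorm_two hv z u) ?_
  set r := ‖divEuclid v u‖ with hr
  have hr2 : ∑ j, (u j / v j) ^ 2 = r ^ 2 := by
    rw [hr, norm_divEuclid, Real.sq_sqrt (Finset.sum_nonneg fun j _ => sq_nonneg _)]
  rcases eq_or_ne r 0 with h0 | h0
  · exact ⟨0, by simp [vNorm_two], by simp [h0]⟩
  -- The equality case of Cauchy-Schwarz: `v_j z_j` is proportional to `u_j / v_j`.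
  · refine ⟨fun j => u j / v j ^ 2 / r, ?_, ?_⟩
    · rw [vNorm_two]
      refine le_of_eq ?_
      have : ∀ j, (v j * (u j / v j ^ 2 / r)) ^ 2 = (u j / v j) ^ 2 / r ^ 2 := fun j => by
        have := (hv j).ne'
        field_simp
      simp_rw [this]
      rw [← Finset.sum_div, hr2, div_self (pow_ne_zero 2 h0), Real.sqrt_one]
    · have : ∀ j, u j / v j ^ 2 / r * u j = (u j / v j) ^ 2 / r := fun j => by
        have := (hv j).ne'
        field_simp
      simp_rw [dotProduct, this]
      rw [← Finset.sum_div, hr2]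
      field_simp

/-! ### Smoothness of the conjugate of a strongly convex function. -/

lemma continuous_vNorm {m : ℕ} {p : ℝ} (hp : 0 < p) (v : Fin m → ℝ) : Continuous (vNorm p v) := by
  unfold vNorm
  refine Continuous.rpow_const ?_ fun _ => Or.inr (by positivity)
  refine continuous_finsetSum _ fun j _ => continuous_const.mul ?_
  exact (continuous_apply j).abs.rpow_const fun _ => Or.inr hp.le

open Filter Topology in
/-- The conjugate of a strongly convex function on a compact set has an affine minorant touching it
at any given point, and the gap is at most quadratic in the dual norm. -/
theorem exists_conjugate_quadratic_bound {m : ℕ} {E : Type*} [NormedAddCommGroup E]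
    [NormedSpace ℝ E] (L : (Fin m → ℝ) →ₗ[ℝ] E) {p : ℝ} (hp : 0 < p) (v : Fin m → ℝ)
    (hL : ∀ z u, z ⬝ᵥ u ≤ vNorm p v z * ‖L u‖)
    {Q : Set (Fin m → ℝ)} (hne : Q.Nonempty) (hQ : IsCompact Q) (hconv : Convex ℝ Q)
    {G : (Fin m → ℝ) → ℝ} {c : ℝ} (hc : 0 < c) (hG : StronglyConvexOn p v Q c G)
    {b : ℝ} (hb : ∀ z ∈ Q, b ≤ G z) (u : Fin m → ℝ) :
    ∃ z₀ : Fin m → ℝ, ∀ h : Fin m → ℝ,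
      sSup ((fun z => u ⬝ᵥ z - G z) '' Q) + h ⬝ᵥ z₀ ≤
        sSup ((fun z => (u + h) ⬝ᵥ z - G z) '' Q) ∧
      sSup ((fun z => (u + h) ⬝ᵥ z - G z) '' Q) ≤
        sSup ((fun z => u ⬝ᵥ z - G z) '' Q) + h ⬝ᵥ z₀ + ‖L h‖ ^ 2 / (2 * c) := by
  have hcd : ∀ y : Fin m → ℝ, Continuous fun z => y ⬝ᵥ z := fun y =>
    continuous_const.dotProduct continuous_id
  have hbdd : ∀ y : Fin m → ℝ, BddAbove ((fun z => y ⬝ᵥ z - G z) '' Q) := fun y => by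
    obtain ⟨M, hM⟩ := (hQ.image (hcd y)).bddAbove
    refine ⟨M - b, ?_⟩
    rintro _ ⟨z, hz, rfl⟩
    exact sub_le_sub (hM ⟨z, hz, rfl⟩) (hb z hz)
  -- The supremum need not be attained, since `G` may fail to be semicontinuous. A limit `z₀` of a
  -- maximizing sequence replaces the maximizer; the value `G z₀` is never used.
  obtain ⟨s, -, hs, hsm⟩ := exists_seq_tendsto_sSup (hne.image _) (hbdd u)
  choose y hyQ hy using hsm
  obtain ⟨z₀, hz₀, ψ, hψ, hlim⟩ := hQ.tendsto_subseq hyQ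
  have hs' : Tendsto (fun k => u ⬝ᵥ y (ψ k) - G (y (ψ k))) atTop
      (𝓝 (sSup ((fun z => u ⬝ᵥ z - G z) '' Q))) := by
    have := hs.comp hψ.tendsto_atTop
    refine this.congr fun k => ?_
    exact (hy (ψ k)).symm
  set F := sSup ((fun z => u ⬝ᵥ z - G z) '' Q) with hF
  refine ⟨z₀, fun h => ⟨?_, ?_⟩⟩
  · have h1 : Tendsto (fun k => u ⬝ᵥ y (ψ k) - G (y (ψ k)) + h ⬝ᵥ y (ψ k)) atTop
        (𝓝 (F + h ⬝ᵥ z₀)) := hs'.add (((hcd h).tendsto z₀).comp hlim)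
    refine le_of_tendsto h1 (Eventually.of_forall fun k => ?_)
    refine le_csSup (hbdd (u + h)) ⟨y (ψ k), hyQ _, ?_⟩
    simp only [add_dotProduct]
    ring
  · refine csSup_le (hne.image _) ?_
    rintro _ ⟨z, hz, rfl⟩
    -- Strong convexity between `z` and the maximizing sequence, passed to the limit and divided by
    -- `t`; then `t → 0` gives quadratic growth away from `z₀`.
    have key : ∀ t : ℝ, 0 < t → t ≤ 1 →
        u ⬝ᵥ z - G z + c / 2 * (1 - t) * vNorm p v (z - z₀) ^ 2 ≤ F := by
      intro t ht ht1
      have h1 : Tendsto (fun k => t * (u ⬝ᵥ z - G z) + (1 - t) * (u ⬝ᵥ y (ψ k) - G (y (ψ k))) +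
          c / 2 * t * (1 - t) * vNorm p v (z - y (ψ k)) ^ 2) atTop
          (𝓝 (t * (u ⬝ᵥ z - G z) + (1 - t) * F +
            c / 2 * t * (1 - t) * vNorm p v (z - z₀) ^ 2)) := by
        refine (tendsto_const_nhds.add (hs'.const_mul _)).add (Tendsto.const_mul _ ?_)
        refine Tendsto.pow ?_ 2
        exact ((continuous_vNorm hp v).tendsto _).comp (tendsto_const_nhds.sub hlim)
      have h2 := le_of_tendsto (b := F) h1 (Eventually.of_forall fun k => by
        have h3 := hG z hz (y (ψ k)) (hyQ _) t ht.le ht1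
        have h4 : u ⬝ᵥ (t • z + (1 - t) • y (ψ k)) - G (t • z + (1 - t) • y (ψ k)) ≤ F :=
          le_csSup (hbdd u) ⟨_, hconv hz (hyQ _) ht.le (by linarith) (by ring), rfl⟩
        rw [dotProduct_add, dotProduct_smul, dotProduct_smul, smul_eq_mul, smul_eq_mul] at h4
        nlinarith)
      have h5 : t * (u ⬝ᵥ z - G z + c / 2 * (1 - t) * vNorm p v (z - z₀) ^ 2) ≤ t * F := by
        linarith
      exact le_of_mul_le_mul_left h5 ht
    have key' : u ⬝ᵥ z - G z + c / 2 * vNorm p v (z - z₀) ^ 2 ≤ F := by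
      have h1 : Tendsto (fun t : ℝ => u ⬝ᵥ z - G z + c / 2 * (1 - t) * vNorm p v (z - z₀) ^ 2)
          (𝓝[>] 0) (𝓝 (u ⬝ᵥ z - G z + c / 2 * (1 - 0) * vNorm p v (z - z₀) ^ 2)) :=
        tendsto_nhdsWithin_of_tendsto_nhds (Continuous.tendsto (by fun_prop) 0)
      rw [sub_zero, mul_one] at h1
      refine le_of_tendsto h1 ?_
      filter_upwards [Ioc_mem_nhdsGT (zero_lt_one' ℝ)] with t ht
      exact key t ht.1 ht.2
    have h6 := hL (z - z₀) h
    rw [sub_dotProduct, dotProduct_comm z h, dotProduct_comm z₀ h] at h6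
    -- Young's inequality: the quadratic growth absorbs the perturbation `h`.
    have h7 : vNorm p v (z - z₀) * ‖L h‖ ≤
        c / 2 * vNorm p v (z - z₀) ^ 2 + ‖L h‖ ^ 2 / (2 * c) := by
      have : c / 2 * vNorm p v (z - z₀) ^ 2 + ‖L h‖ ^ 2 / (2 * c) -
          vNorm p v (z - z₀) * ‖L h‖ = (c * vNorm p v (z - z₀) - ‖L h‖) ^ 2 / (2 * c) := by
        field_simp
        ring
      have : 0 ≤ (c * vNorm p v (z - z₀) - ‖L h‖) ^ 2 / (2 * c) := by positivity
      linarith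
    simp only [add_dotProduct]
    linarith

/-- Every point has a gradient of the smoothed function, with a quadratic upper bound. -/
theorem exists_gradient_smoothed {m n : ℕ} {N : Fin n → ℕ} {E : Type*} [NormedAddCommGroup E]
    [NormedSpace ℝ E] (L : (Fin m → ℝ) →ₗ[ℝ] E) {p : ℝ} (hp : 0 < p) (v : Fin m → ℝ)
    (hL : ∀ z u, z ⬝ᵥ u ≤ vNorm p v z * ‖L u‖)
    (A : Matrix (Fin m) (Σ i : Fin n, Fin (N i)) ℝ)
    {Q : Set (Fin m → ℝ)} (hne : Q.Nonempty) (hQ : IsCompact Q) (hconv : Convex ℝ Q)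
    {g d : (Fin m → ℝ) → ℝ} (hg : ConvexOn ℝ Set.univ g) {σ μ : ℝ} (hσ : 0 < σ) (hμ : 0 < μ)
    (hd : IsProxFunction p v Q σ d) (x : BlockSpace N) :
    ∃ y : BlockSpace N, HasGradientAt (smoothed A Q g d μ) y x ∧ ∀ h : BlockSpace N,
      smoothed A Q g d μ (x + h) ≤
        smoothed A Q g d μ x + inner ℝ y h + ‖L (A *ᵥ h.ofLp)‖ ^ 2 / (2 * (μ * σ)) := by
  obtain ⟨hsc, hd0, -⟩ := hd
  have hgc : Continuous g := continuousOn_univ.1 (hg.continuousOn isOpen_univ)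
  obtain ⟨b, hb⟩ := (hQ.image hgc).bddBelow
  have hG : StronglyConvexOn p v Q (μ * σ) (fun z => g z + μ * d z) := by
    intro z₁ h₁ z₂ h₂ t ht ht1
    have e1 := hsc z₁ h₁ z₂ h₂ t ht ht1
    have e2 := hg.2 (Set.mem_univ z₁) (Set.mem_univ z₂) ht (sub_nonneg.2 ht1) (by ring)
    simp only [smul_eq_mul] at e2
    have e3 := mul_le_mul_of_nonneg_left e1 hμ.le
    dsimp only
    linarith
  obtain ⟨z₀, hz₀⟩ := exists_conjugate_quadratic_bound L hp v hL hne hQ hconv (mul_pos hμ hσ) hG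
    (b := b) (fun z hz => by
      have e1 : b ≤ g z := hb ⟨z, hz, rfl⟩
      have e2 := mul_nonneg hμ.le (hd0 z hz)
      linarith) (A *ᵥ x.ofLp)
  have hsm : ∀ x : BlockSpace N, smoothed A Q g d μ x =
      sSup ((fun z => (A *ᵥ x.ofLp) ⬝ᵥ z - (g z + μ * d z)) '' Q) := fun x => by
    simp only [smoothed, sub_sub]
  have hin : ∀ h : BlockSpace N,
      inner ℝ (WithLp.toLp 2 (Aᵀ *ᵥ z₀) : BlockSpace N) h = (A *ᵥ h.ofLp) ⬝ᵥ z₀ := fun h => by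
    rw [EuclideanSpace.inner_eq_star_dotProduct, star_trivial, mulVec_transpose,
      dotProduct_comm, ← dotProduct_mulVec, dotProduct_comm]
  have hb2 : ∀ h : BlockSpace N,
      smoothed A Q g d μ x + inner ℝ (WithLp.toLp 2 (Aᵀ *ᵥ z₀) : BlockSpace N) h ≤
        smoothed A Q g d μ (x + h) ∧ smoothed A Q g d μ (x + h) ≤
        smoothed A Q g d μ x + inner ℝ (WithLp.toLp 2 (Aᵀ *ᵥ z₀) : BlockSpace N) h +
          ‖L (A *ᵥ h.ofLp)‖ ^ 2 / (2 * (μ * σ)) := fun h => by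
    have := hz₀ (A *ᵥ h.ofLp)
    rw [← mulVec_add] at this
    rw [hin, hsm, hsm]
    exact this
  refine ⟨WithLp.toLp 2 (Aᵀ *ᵥ z₀), ?_, fun h => (hb2 h).2⟩
  rw [hasGradientAt_iff_isLittleO_nhds_zero]
  let T : BlockSpace N →L[ℝ] E := LinearMap.toContinuousLinearMap
    (L ∘ₗ A.mulVecLin ∘ₗ (WithLp.linearEquiv 2 ℝ ((Σ i : Fin n, Fin (N i)) → ℝ)).toLinearMap)
  have hT : ∀ h : BlockSpace N, L (A *ᵥ h.ofLp) = T h := fun h => rfl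
  -- The remainder lies between `0` and a multiple of `‖h‖²`, so the candidate `Aᵀ z₀` is the
  -- gradient.
  have hO : (fun h : BlockSpace N => smoothed A Q g d μ (x + h) - smoothed A Q g d μ x -
      inner ℝ (WithLp.toLp 2 (Aᵀ *ᵥ z₀) : BlockSpace N) h) =O[nhds 0]
      fun h => ‖h‖ ^ 2 := by
    refine Asymptotics.IsBigO.of_bound (‖T‖ ^ 2 / (2 * (μ * σ))) (Filter.Eventually.of_forall ?_)
    intro h
    obtain ⟨e1, e2⟩ := hb2 h
    rw [Real.norm_of_nonneg (by linarith), Real.norm_of_nonneg (by positivity)]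
    rw [hT] at e2
    have e3 : ‖T h‖ ^ 2 / (2 * (μ * σ)) ≤ ‖T‖ ^ 2 / (2 * (μ * σ)) * ‖h‖ ^ 2 := by
      rw [div_mul_eq_mul_div, ← mul_pow]
      gcongr
      exact T.le_opNorm h
    linarith
  refine hO.trans_isLittleO ?_
  exact Asymptotics.isLittleO_norm_pow_id one_lt_two

/-! ### The weights `w^*` and block decompositions. -/

section Weights

variable {m n : ℕ} {N : Fin n → ℕ} {E : Type*} [NormedAddCommGroup E] [NormedSpace ℝ E]

/-- Compactness of the unit sphere makes the supremum genuine rather than a default value. -/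
lemma norm_sq_le_wStar_of_unit (L : (Fin m → ℝ) →ₗ[ℝ] E) {p : ℝ} {v : Fin m → ℝ}
    (hL : ∀ u, vDualNorm p v u = ‖L u‖) (A : Matrix (Fin m) (Σ i : Fin n, Fin (N i)) ℝ)
    (B : (i : Fin n) → Matrix (Fin (N i)) (Fin (N i)) ℝ) (i : Fin n)
    (t : EuclideanSpace ℝ (Fin (N i))) (ht : ‖t‖ = 1) :
    ‖L (colBlock A i *ᵥ ((CFC.sqrt (B i))⁻¹ *ᵥ t.ofLp))‖ ^ 2 ≤ wStar p v A B i := by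
  unfold wStar
  simp_rw [hL]
  have hcont : Continuous fun t : EuclideanSpace ℝ (Fin (N i)) =>
      ‖L (colBlock A i *ᵥ ((CFC.sqrt (B i))⁻¹ *ᵥ t.ofLp))‖ ^ 2 := by
    have := LinearMap.continuous_of_finiteDimensional (L ∘ₗ (colBlock A i).mulVecLin ∘ₗ
      ((CFC.sqrt (B i))⁻¹).mulVecLin ∘ₗ (WithLp.linearEquiv 2 ℝ (Fin (N i) → ℝ)).toLinearMap)
    exact this.norm.pow 2
  have hcpt : IsCompact {t : EuclideanSpace ℝ (Fin (N i)) | ‖t‖ = 1} := by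
    have h : {t : EuclideanSpace ℝ (Fin (N i)) | ‖t‖ = 1} = Metric.sphere 0 1 :=
      Set.ext fun t => mem_sphere_zero_iff_norm.symm
    rw [h]
    exact isCompact_sphere _ _
  exact le_csSup (hcpt.image hcont).bddAbove ⟨t, ht, rfl⟩

lemma norm_sq_le_wStar_mul (L : (Fin m → ℝ) →ₗ[ℝ] E) {p : ℝ} {v : Fin m → ℝ}
    (hL : ∀ u, vDualNorm p v u = ‖L u‖) (A : Matrix (Fin m) (Σ i : Fin n, Fin (N i)) ℝ)
    (B : (i : Fin n) → Matrix (Fin (N i)) (Fin (N i)) ℝ) (i : Fin n)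
    (t : EuclideanSpace ℝ (Fin (N i))) :
    ‖L (colBlock A i *ᵥ ((CFC.sqrt (B i))⁻¹ *ᵥ t.ofLp))‖ ^ 2 ≤ wStar p v A B i * ‖t‖ ^ 2 := by
  rcases eq_or_ne t 0 with rfl | ht
  · simp
  have h0 : 0 < ‖t‖ := norm_pos_iff.2 ht
  have := norm_sq_le_wStar_of_unit L hL A B i (‖t‖⁻¹ • t) (by
    rw [norm_smul, norm_inv, norm_norm, inv_mul_cancel₀ h0.ne'])
  rw [WithLp.ofLp_smul, mulVec_smul, mulVec_smul, map_smul, norm_smul, norm_inv, norm_norm,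
    mul_pow, inv_pow, inv_mul_eq_div, div_le_iff₀ (by positivity)] at this
  exact this

lemma isUnit_det_sqrt {k : ℕ} {M : Matrix (Fin k) (Fin k) ℝ} (hM : M.PosDef) :
    IsUnit (CFC.sqrt M).det := by
  have h := CFC.sqrt_mul_sqrt_self M hM.posSemidef.nonneg
  have h2 := congrArg det h
  rw [det_mul] at h2
  refine isUnit_iff_ne_zero.2 fun h0 => hM.det_pos.ne' ?_
  rw [← h2, h0, zero_mul]

/-- If the weight were nonpositive, the choice `t = B_i^{1/2} y` would give `L (A_i y) = 0` for
every `y`, hence `A_i = 0` by injectivity. -/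
lemma wStar_pos (L : (Fin m → ℝ) →ₗ[ℝ] E) (hinj : Function.Injective L) {p : ℝ}
    {v : Fin m → ℝ} (hL : ∀ u, vDualNorm p v u = ‖L u‖)
    (A : Matrix (Fin m) (Σ i : Fin n, Fin (N i)) ℝ) (hA : ∀ i, colBlock A i ≠ 0)
    (B : (i : Fin n) → Matrix (Fin (N i)) (Fin (N i)) ℝ) (hB : ∀ i, (B i).PosDef) (i : Fin n) :
    0 < wStar p v A B i := by
  by_contra! hle
  refine hA i (Matrix.mulVec_injective ?_)
  ext1 y
  have h := norm_sq_le_wStar_mul L hL A B i (WithLp.toLp 2 (CFC.sqrt (B i) *ᵥ y))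
  rw [WithLp.ofLp_toLp, mulVec_mulVec y, nonsing_inv_mul _ (isUnit_det_sqrt (hB i)),
    one_mulVec] at h
  have h2 := h.trans (mul_nonpos_of_nonpos_of_nonneg hle (sq_nonneg _))
  have h3 : ‖L (colBlock A i *ᵥ y)‖ = 0 := by
    have := sq_nonneg ‖L (colBlock A i *ᵥ y)‖
    exact pow_eq_zero_iff two_ne_zero |>.1 (le_antisymm h2 this)
  rw [zero_mulVec]
  exact hinj (by rw [map_zero]; exact norm_eq_zero.1 h3)

/-- Substitute `t = B_i^{1/2} y`, for which `‖t‖² = ⟨B_i y, y⟩`. -/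
lemma norm_sq_colBlock_le (L : (Fin m → ℝ) →ₗ[ℝ] E) {p : ℝ} {v : Fin m → ℝ}
    (hL : ∀ u, vDualNorm p v u = ‖L u‖) (A : Matrix (Fin m) (Σ i : Fin n, Fin (N i)) ℝ)
    (B : (i : Fin n) → Matrix (Fin (N i)) (Fin (N i)) ℝ) (hB : ∀ i, (B i).PosDef) (i : Fin n)
    (y : Fin (N i) → ℝ) :
    ‖L (colBlock A i *ᵥ y)‖ ^ 2 ≤ wStar p v A B i * ((B i *ᵥ y) ⬝ᵥ y) := by
  have h := norm_sq_le_wStar_mul L hL A B i (WithLp.toLp 2 (CFC.sqrt (B i) *ᵥ y))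
  rw [WithLp.ofLp_toLp, mulVec_mulVec y, nonsing_inv_mul _ (isUnit_det_sqrt (hB i)),
    one_mulVec] at h
  refine h.trans (le_of_eq ?_)
  congr 1
  have hs : (CFC.sqrt (B i))ᵀ = CFC.sqrt (B i) := by
    have := (CFC.sqrt_nonneg (B i)).posSemidef.isHermitian
    rwa [IsHermitian, conjTranspose_eq_transpose_of_trivial] at this
  rw [EuclideanSpace.real_norm_sq_eq]
  have h1 : ∑ j, (CFC.sqrt (B i) *ᵥ y) j ^ 2 =
      (CFC.sqrt (B i) *ᵥ y) ⬝ᵥ (CFC.sqrt (B i) *ᵥ y) := by simp [dotProduct, sq]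
  change ∑ j, (CFC.sqrt (B i) *ᵥ y) j ^ 2 = _
  rw [h1, dotProduct_mulVec, ← mulVec_transpose, hs, mulVec_mulVec,
    CFC.sqrt_mul_sqrt_self (B i) (hB i).posSemidef.nonneg]

lemma mulVec_restrictBlocks (A : Matrix (Fin m) (Σ i : Fin n, Fin (N i)) ℝ)
    (h : BlockSpace N) (T : Finset (Fin n)) :
    A *ᵥ (restrictBlocks h T).ofLp = ∑ i ∈ T, colBlock A i *ᵥ block h i := by
  ext j
  rw [Finset.sum_apply]
  simp only [mulVec, dotProduct, restrictBlocks, colBlock, block, submatrix_apply, id]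
  rw [Fintype.sum_sigma, ← Finset.sum_filter_add_sum_filter_not Finset.univ (· ∈ T)]
  rw [Finset.sum_eq_zero (s := Finset.univ.filter (· ∉ T))]
  · rw [add_zero, Finset.filter_univ_mem]
    refine Finset.sum_congr rfl fun i hi => ?_
    simp [hi]
  · intro i hi
    simp only [Finset.mem_filter, Finset.mem_univ, true_and] at hi
    simp [hi]

lemma inner_restrictBlocks (y h : BlockSpace N) (T : Finset (Fin n)) :
    inner ℝ y (restrictBlocks h T) = ∑ i ∈ T, block y i ⬝ᵥ block h i := by
  simp only [PiLp.inner_apply, restrictBlocks, block, dotProduct]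
  rw [Fintype.sum_sigma, ← Finset.sum_filter_add_sum_filter_not Finset.univ (· ∈ T)]
  rw [Finset.sum_eq_zero (s := Finset.univ.filter (· ∉ T))]
  · rw [add_zero, Finset.filter_univ_mem]
    refine Finset.sum_congr rfl fun i hi => ?_
    simp [hi, mul_comm]
  · intro i hi
    simp only [Finset.mem_filter, Finset.mem_univ, true_and] at hi
    simp [hi]

lemma inner_eq_sum_block (y h : BlockSpace N) :
    inner ℝ y h = ∑ i, block y i ⬝ᵥ block h i := by
  rw [← inner_restrictBlocks]
  congr 1
  ext c
  simp [restrictBlocks]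

end Weights

/-! ### Expectation under a nice sampling. -/

section Sampling

variable {n : ℕ} {Om : Type*} [MeasurableSpace Om] {P : Measure Om}
  {τ : ℕ} {S : Om → Finset (Fin n)}

theorem IsTauNice.le (hS : IsTauNice P τ S) : τ ≤ n := by
  by_contra! h
  have h1 := hS.1.2
  have : {s | (S s).card = τ} = ∅ := by
    ext s
    have := (S s).card_le_univ
    simp at this ⊢
    omega
  simp [this] at h1

/-- Expectation under a `τ`-nice sampling is the average over the subsets of cardinality `τ`. -/
theorem IsTauNice.integral_eq [IsProbabilityMeasure P] (hS : IsTauNice P τ S) (φ : Finset (Fin n) → ℝ) :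
    ∫ s, φ (S s) ∂P = (∑ T ∈ Finset.univ.powersetCard τ, φ T) / n.choose τ := by
  classical
  have hle := hS.le
  obtain ⟨⟨⟨hmeas, -⟩, hcard⟩, heq⟩ := hS
  let _ : MeasurableSpace (Finset (Fin n)) := ⊤
  have hSm : Measurable S := measurable_to_countable' hmeas
  have : IsProbabilityMeasure (P.map S) := Measure.isProbabilityMeasure_map hSm.aemeasurable
  rw [← integral_map (f := φ) hSm.aemeasurable (measurable_from_top.aestronglyMeasurable),
    integral_fintype Integrable.of_finite]
  have hreal : ∀ T, (P.map S).real {T} = P.real {s | S s = T} := fun T => by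
    rw [map_measureReal_apply hSm (measurableSet_singleton _)]; rfl
  have hmT : ∀ T, MeasurableSet {s | S s = T} := fun T => hmeas T
  have hmc : MeasurableSet {s | (S s).card = τ} := hSm (t := {T | T.card = τ}) trivial
  have hzero : ∀ T : Finset (Fin n), T.card ≠ τ → P.real {s | S s = T} = 0 := by
    intro T hT
    have h1 : P {s | (S s).card = τ}ᶜ = 0 := (prob_compl_eq_zero_iff hmc).2 hcard
    rw [measureReal_eq_zero_iff]
    exact measure_mono_null (fun s (hs : S s = T) => by simp [hs, hT]) h1
  obtain ⟨T₀, -, hT₀⟩ := Finset.exists_subset_card_eq (s := (Finset.univ : Finset (Fin n)))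
    (by simpa using hle)
  have hconst : ∀ T ∈ Finset.univ.powersetCard τ, P.real {s | S s = T} = P.real {s | S s = T₀} :=
    fun T hT => by
      rw [Measure.real, Measure.real, heq T T₀ (Finset.mem_powersetCard.1 hT).2 hT₀]
  have hsplit : ∀ ψ : Finset (Fin n) → ℝ, ∑ T, P.real {s | S s = T} * ψ T =
      P.real {s | S s = T₀} * ∑ T ∈ Finset.univ.powersetCard τ, ψ T := fun ψ => by
    rw [Finset.mul_sum, ← Finset.sum_subset (Finset.subset_univ (Finset.univ.powersetCard τ))]
    · exact Finset.sum_congr rfl fun T hT => by rw [hconst T hT]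
    · intro T _ hT
      rw [hzero T (by simpa using hT), zero_mul]
  -- Testing with the constant `1` identifies the common probability.
  have hone : P.real {s | S s = T₀} * n.choose τ = 1 := by
    have h1 := hsplit fun _ => 1
    simp only [mul_one, Finset.sum_const, Finset.card_powersetCard, Finset.card_univ,
      Fintype.card_fin, nsmul_eq_mul] at h1
    rw [← h1]
    simp_rw [← hreal]
    rw [sum_measureReal_singleton]
    simp
  have hch : (n.choose τ : ℝ) ≠ 0 := by
    intro h
    simp [h] at hone
  simp_rw [smul_eq_mul, hreal]
  rw [hsplit, eq_div_iff hch, mul_right_comm, hone, one_mul]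

end Sampling

/-! ### Double counting over subsets of fixed size. -/

section Counting

variable {ι : Type*} [DecidableEq ι]

/-- Each element lies in `C(|Ω| - 1, l - 1)` of the subsets when `l ≥ 1`. The factor `|Ω|` avoids
division, so empty `Ω` is allowed. -/
lemma sum_powersetCard_sum (Ω : Finset ι) (l : ℕ) (q : ι → ℝ) :
    (Ω.card : ℝ) * ∑ U ∈ Ω.powersetCard l, ∑ i ∈ U, q i =
      l * (Ω.card.choose l : ℝ) * ∑ i ∈ Ω, q i := by
  rcases l with _ | l
  · simp
  have h1 : ∑ U ∈ Ω.powersetCard (l + 1), ∑ i ∈ U, q i =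
      ((Ω.card - 1).choose l : ℝ) * ∑ i ∈ Ω, q i := by
    rw [Finset.mul_sum, Finset.sum_comm' (t' := Ω)
      (s' := fun i => (Ω.powersetCard (l + 1)).filter ({i} ⊆ ·))]
    · refine Finset.sum_congr rfl fun i hi => ?_
      rw [Finset.sum_const, Finset.card_filter_powersetCard_subset _ _ _ (by simpa using hi)
        (by simp), nsmul_eq_mul]
      simp
    · intro U i
      simp only [Finset.mem_filter, Finset.mem_powersetCard, Finset.singleton_subset_iff]
      exact ⟨fun h => ⟨h, h.1.1 h.2⟩, fun h => h.1⟩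
  rw [h1]
  rcases Nat.eq_zero_or_pos Ω.card with h0 | h0
  · simp [Finset.card_eq_zero.1 h0]
  · obtain ⟨c, hc⟩ := Nat.exists_eq_succ_of_ne_zero h0.ne'
    rw [hc, Nat.succ_sub_one, ← mul_assoc]
    congr 1
    have := Nat.add_one_mul_choose_eq c l
    rw [mul_comm] at this
    rw [mul_comm, mul_comm ((l + 1 : ℕ) : ℝ)]
    exact_mod_cast this

/-- Expand the square: a pair `i ≠ j` lies in `C(|Ω| - 2, l)` subsets, a diagonal pair in `C(|Ω| -
1, l + 1)`. -/
lemma sum_powersetCard_sq_sum (Ω : Finset ι) (l : ℕ) (a : ι → ℝ) :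
    ∑ U ∈ Ω.powersetCard (l + 2), (∑ i ∈ U, a i) ^ 2 =
      (((Ω.card - 1).choose (l + 1) : ℝ) - (Ω.card - 2).choose l) * ∑ i ∈ Ω, a i ^ 2 +
        (Ω.card - 2).choose l * (∑ i ∈ Ω, a i) ^ 2 := by
  have h1 : ∀ U ∈ Ω.powersetCard (l + 2), (∑ i ∈ U, a i) ^ 2 =
      ∑ x ∈ Ω ×ˢ Ω, if {x.1, x.2} ⊆ U then a x.1 * a x.2 else 0 := by
    intro U hU
    have hU' := (Finset.mem_powersetCard.1 hU).1
    rw [sq, Finset.sum_mul_sum, ← Finset.sum_product', ← Finset.sum_filter]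
    refine Finset.sum_congr ?_ fun _ _ => rfl
    ext ⟨i, j⟩
    simp only [Finset.mem_product, Finset.mem_filter, Finset.insert_subset_iff,
      Finset.singleton_subset_iff]
    exact ⟨fun h => ⟨⟨hU' h.1, hU' h.2⟩, h⟩, fun h => h.2⟩
  rw [Finset.sum_congr rfl h1, Finset.sum_comm]
  have h2 : ∀ x ∈ Ω ×ˢ Ω,
      (∑ U ∈ Ω.powersetCard (l + 2), if {x.1, x.2} ⊆ U then a x.1 * a x.2 else 0) =
      (if x.1 = x.2 then
        (((Ω.card - 1).choose (l + 1) : ℝ) - (Ω.card - 2).choose l) * (a x.1 * a x.2) else 0) +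
        (Ω.card - 2).choose l * (a x.1 * a x.2) := by
    rintro ⟨i, j⟩ hx
    rw [Finset.mem_product] at hx
    have hsub : ({i, j} : Finset ι) ⊆ Ω := by
      simpa [Finset.insert_subset_iff] using hx
    rw [← Finset.sum_filter, Finset.sum_const, nsmul_eq_mul]
    dsimp only
    rcases eq_or_ne i j with rfl | hij
    · rw [Finset.card_filter_powersetCard_subset _ _ _ hsub (by simp)]
      simp
      ring
    · rw [Finset.card_filter_powersetCard_subset _ _ _ hsub (by simp [Finset.card_pair hij])]
      simp [Finset.card_pair hij, hij]
  rw [Finset.sum_congr rfl h2, Finset.sum_add_distrib, ← Finset.mul_sum,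
    Finset.sum_product, Finset.sum_product]
  congr 1
  · rw [Finset.mul_sum]
    refine Finset.sum_congr rfl fun i hi => ?_
    simp [hi, sq]
  · rw [sq, Finset.sum_mul_sum]

/-- A set `T` splits into `T ∩ R` and `T \ R`; once the first is fixed, the second is any `τ - l`
elements outside `R`. -/
lemma sum_powersetCard_filter_inter [Fintype ι] (R : Finset ι) {τ l : ℕ} (hl : l ≤ τ)
    (ψ : Finset ι → ℝ) :
    ∑ T ∈ (Finset.univ.powersetCard τ).filter (fun T => (T ∩ R).card = l), ψ (T ∩ R) =
      ((Fintype.card ι - R.card).choose (τ - l) : ℝ) * ∑ U ∈ R.powersetCard l, ψ U := by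
  rw [Finset.mul_sum, ← Finset.sum_fiberwise_of_maps_to (g := (· ∩ R)) (t := R.powersetCard l)]
  · refine Finset.sum_congr rfl fun U hU => ?_
    obtain ⟨hUR, hUc⟩ := Finset.mem_powersetCard.1 hU
    rw [Finset.sum_congr rfl (g := fun _ => ψ U)
      (fun T hT => by rw [(Finset.mem_filter.1 hT).2]), Finset.sum_const, nsmul_eq_mul]
    congr 2
    rw [← Finset.card_compl, ← Finset.card_powersetCard]
    refine Finset.card_nbij' (· \ R) (· ∪ U) ?_ ?_ ?_ ?_
    · intro T hT
      simp only [Finset.coe_filter, Finset.mem_filter, Finset.mem_powersetCard, Set.mem_ofPred_eq,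
        Finset.subset_univ, true_and] at hT
      simp only [Finset.mem_coe,
        Finset.mem_powersetCard]
      refine ⟨fun x hx => by simp at hx ⊢; exact hx.2, ?_⟩
      have := Finset.card_sdiff_add_card_inter T R
      omega
    · intro W hW
      simp only [Finset.mem_coe,
        Finset.mem_powersetCard] at hW
      simp only [Finset.coe_filter, Finset.mem_filter, Finset.mem_powersetCard, Set.mem_ofPred_eq,
        Finset.subset_univ, true_and]
      have hd : Disjoint W R := Finset.subset_compl_iff_disjoint_right.1 hW.1
      have hinter : (W ∪ U) ∩ R = U := by
        rw [Finset.union_inter_distrib_right, Finset.disjoint_iff_inter_eq_empty.1 hd,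
          Finset.empty_union, Finset.inter_eq_left.2 hUR]
      rw [hinter, Finset.card_union_of_disjoint (hd.mono_right hUR)]
      refine ⟨⟨by omega, hUc⟩, rfl⟩
    · intro T hT
      simp only [Finset.coe_filter, Finset.mem_filter, Set.mem_ofPred_eq] at hT
      rw [← hT.2]
      exact Finset.sdiff_union_inter T R
    · intro W hW
      simp only [Finset.mem_coe,
        Finset.mem_powersetCard] at hW
      have hd : Disjoint W R := Finset.subset_compl_iff_disjoint_right.1 hW.1
      dsimp only
      rw [Finset.union_sdiff_distrib, Finset.sdiff_eq_self_of_disjoint hd,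
        Finset.sdiff_eq_empty_iff_subset.2 hUR, Finset.union_empty]
  · intro T hT
    exact Finset.mem_powersetCard.2 ⟨Finset.inter_subset_right, (Finset.mem_filter.1 hT).2⟩

end Counting

/-! ### The constants `β'` for `p = 2` and `p = 1`. -/

/-- Second moment bound for a vector with at most `ω` nonzero entries. -/
theorem sum_sq_sum_le_betaTwo {n ω τ : ℕ} (hτ : 1 ≤ τ) (hτn : τ ≤ n) (R : Finset (Fin n))
    (hR : R.card ≤ ω) (a : Fin n → ℝ) (ha : ∀ i ∉ R, a i = 0) :
    ∑ T ∈ Finset.univ.powersetCard τ, (∑ i ∈ T, a i) ^ 2 ≤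
      n.choose τ * (τ / n * (betaTwo n ω τ * ∑ i, a i ^ 2)) := by
  have hn0 : (n : ℝ) ≠ 0 := by
    have : 0 < n := by omega
    positivity
  obtain ⟨l, rfl⟩ := Nat.exists_eq_add_of_le' hτ
  rcases l with _ | l
  · rw [Finset.powersetCard_one, Finset.sum_map]
    simp [betaTwo]
    field_simp
    rfl
  · rw [sum_powersetCard_sq_sum, Finset.card_univ, Fintype.card_fin]
    obtain ⟨k, rfl⟩ := Nat.exists_eq_add_of_le' (show 2 ≤ n by omega)
    have hsq : (∑ i, a i) ^ 2 ≤ ω * ∑ i, a i ^ 2 := by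
      rw [← Finset.sum_subset (Finset.subset_univ R) fun i _ hi => ha i hi]
      refine (sq_sum_le_card_mul_sum_sq).trans ?_
      have h1 : ∑ i ∈ R, a i ^ 2 ≤ ∑ i, a i ^ 2 :=
        Finset.sum_le_sum_of_subset_of_nonneg (Finset.subset_univ R) fun i _ _ => sq_nonneg _
      have h2 : (R.card : ℝ) ≤ ω := by exact_mod_cast hR
      have h3 : 0 ≤ ∑ i ∈ R, a i ^ 2 := Finset.sum_nonneg fun i _ => sq_nonneg _
      gcongr
    have hc1 : ((k + 2 : ℕ) : ℝ) * (k + 1).choose (l + 1) =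
        (k + 2).choose (l + 2) * ((l + 2 : ℕ) : ℝ) := by
      exact_mod_cast Nat.add_one_mul_choose_eq (k + 1) (l + 1)
    have hc2 : ((k + 1 : ℕ) : ℝ) * k.choose l = (k + 1).choose (l + 1) * ((l + 1 : ℕ) : ℝ) := by
      exact_mod_cast Nat.add_one_mul_choose_eq k l
    have e1 : k + 2 - 1 = k + 1 := rfl
    have e2 : k + 2 - 2 = k := rfl
    rw [e1, e2]
    -- Once `(∑ a_i)²` is replaced by `ω ∑ a_i²`, the counts give `betaTwo` exactly, so
    -- Cauchy-Schwarz is the only loss.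
    have hb : ((k + 2).choose (l + 2) : ℝ) * (((l + 1 + 1 : ℕ) : ℝ) / ((k + 2 : ℕ) : ℝ) *
        (betaTwo (k + 2) ω (l + 1 + 1) * ∑ i, a i ^ 2)) =
        (((k + 1).choose (l + 1) : ℝ) - k.choose l) * ∑ i, a i ^ 2 +
          k.choose l * (ω * ∑ i, a i ^ 2) := by
      have hmax : max 1 (((k + 2 : ℕ) : ℝ) - 1) = k + 1 := by
        rw [max_eq_right] <;> push_cast <;> linarith [(Nat.cast_nonneg k : (0 : ℝ) ≤ k)]
      have hk1 : (k : ℝ) + 1 ≠ 0 := by positivity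
      have hk2 : (k : ℝ) + 2 ≠ 0 := by positivity
      rw [betaTwo, hmax]
      push_cast at hc1 hc2 ⊢
      have hx : (k.choose l : ℝ) = (k + 1).choose (l + 1) * (l + 1) / (k + 1) := by
        rw [eq_div_iff hk1, ← hc2]; ring
      have hy : ((k + 2).choose (l + 2) : ℝ) * ((l + 2) / (k + 2)) = (k + 1).choose (l + 1) := by
        rw [← mul_div_assoc, div_eq_iff hk2, ← hc1]; ring
      rw [show (l : ℝ) + 1 + 1 = l + 2 by ring, ← mul_assoc, hy, hx]
      field_simp
      ring
    change _ ≤ ((k + 2).choose (l + 2) : ℝ) * (((l + 1 + 1 : ℕ) : ℝ) / ((k + 2 : ℕ) : ℝ) *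
        (betaTwo (k + 2) ω (l + 1 + 1) * ∑ i, a i ^ 2))
    rw [hb]
    gcongr

lemma betaTwo_pos {n ω τ : ℕ} (hω : 1 ≤ ω) (hτ : 1 ≤ τ) : 0 < betaTwo n ω τ := by
  have h1 : (1 : ℝ) ≤ ω := by exact_mod_cast hω
  have h2 : (1 : ℝ) ≤ τ := by exact_mod_cast hτ
  have h3 : 0 ≤ ((ω : ℝ) - 1) * ((τ : ℝ) - 1) / max 1 ((n : ℝ) - 1) :=
    div_nonneg (mul_nonneg (by linarith) (by linarith)) (by positivity)
  unfold betaTwo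
  linarith

lemma div_le_cCoef (n ω τ l : ℕ) : (l : ℝ) / ω ≤ cCoef n ω τ l := by
  unfold cCoef
  split_ifs
  · exact le_max_left _ _
  · exact le_rfl

lemma cCoef_mul_piProb_nonneg (n ω τ l : ℕ) : 0 ≤ cCoef n ω τ l * piProb n ω τ l :=
  mul_nonneg ((by positivity : (0 : ℝ) ≤ l / ω).trans (div_le_cCoef n ω τ l))
    (by unfold piProb; positivity)

lemma betaThree_pos {m n ω τ : ℕ} (hm : 1 ≤ m) (hω : 1 ≤ ω) (hωn : ω ≤ n) (hτ : 1 ≤ τ)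
    (hτn : τ ≤ n) : 0 < betaThree m n ω τ := by
  have hm' : (0 : ℝ) < m := by exact_mod_cast hm
  have hn' : (0 : ℝ) < n := by exact_mod_cast (by omega : 0 < n)
  have hτ' : (0 : ℝ) < τ := by exact_mod_cast hτ
  have hω' : (0 : ℝ) < ω := by exact_mod_cast hω
  have hk : 1 ≤ kMax ω τ := le_min hτ hω
  unfold betaThree
  refine Finset.sum_pos' (fun k _ => le_min zero_le_one (mul_nonneg (by positivity)
    (Finset.sum_nonneg fun l _ => cCoef_mul_piProb_nonneg n ω τ l))) ⟨1, by simpa using hk, ?_⟩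
  refine lt_min one_pos (mul_pos (by positivity) ?_)
  -- The largest overlap `l = kMax` has positive probability, so the `k = 1` term is positive.
  refine Finset.sum_pos' (fun l _ => cCoef_mul_piProb_nonneg n ω τ l) ⟨kMax ω τ, ?_, ?_⟩
  · simp only [Finset.mem_Icc, le_refl, and_true, kMin, kMax]
    omega
  · refine mul_pos (lt_of_lt_of_le ?_ (div_le_cCoef n ω τ _)) ?_
    · have : (0 : ℝ) < kMax ω τ := by exact_mod_cast hk
      positivity
    · have h1 := Nat.choose_pos (show kMax ω τ ≤ ω from min_le_right _ _)
      have h2 := Nat.choose_pos (show τ - kMax ω τ ≤ n - ω by unfold kMax; omega)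
      have h3 := Nat.choose_pos hτn
      unfold piProb
      positivity

/-- For a `τ`-nice sampling, the part of the weight of `T ∩ R` carried by the event
`k ≤ |T ∩ R|` is controlled by the hypergeometric distribution. -/
lemma sum_inter_le {n ω τ : ℕ} (hω : 1 ≤ ω) (hτn : τ ≤ n) (R : Finset (Fin n))
    (hR : R.card = ω) (q : Fin n → ℝ) (hq : ∀ i, 0 ≤ q i) (k : ℕ) (hk : 1 ≤ k) :
    ∑ T ∈ Finset.univ.powersetCard τ, (if k ≤ (T ∩ R).card then ∑ i ∈ T ∩ R, q i else 0) ≤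
      n.choose τ * ((∑ l ∈ Finset.Icc (max k (kMin n ω τ)) (kMax ω τ),
        cCoef n ω τ l * piProb n ω τ l) * ∑ i, q i) := by
  have hch : (0 : ℝ) < n.choose τ := by exact_mod_cast Nat.choose_pos hτn
  have hω' : (0 : ℝ) < ω := by exact_mod_cast hω
  rw [← Finset.sum_filter, Finset.sum_mul, Finset.mul_sum,
    ← Finset.sum_fiberwise_of_maps_to (g := fun T => (T ∩ R).card)
      (t := Finset.Icc (max k (kMin n ω τ)) (kMax ω τ))]
  · refine Finset.sum_le_sum fun l hl => ?_
    rw [Finset.mem_Icc] at hl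
    have hlk : k ≤ l := (le_max_left _ _).trans hl.1
    have hlτ : l ≤ τ := hl.2.trans (min_le_left _ _)
    rw [Finset.filter_filter, Finset.filter_congr (q := fun T => (T ∩ R).card = l)
      (fun T _ => ⟨fun h => h.2, fun h => ⟨h ▸ hlk, h⟩⟩),
      sum_powersetCard_filter_inter R hlτ fun U => ∑ i ∈ U, q i, Fintype.card_fin, hR]
    have h1 := sum_powersetCard_sum R l q
    rw [hR] at h1
    have h2 : ∑ U ∈ R.powersetCard l, ∑ i ∈ U, q i = l / ω * (ω.choose l * ∑ i ∈ R, q i) := by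
      field_simp
      linarith
    have h3 : ∑ i ∈ R, q i ≤ ∑ i, q i :=
      Finset.sum_le_sum_of_subset_of_nonneg (Finset.subset_univ R) fun i _ _ => hq i
    have h4 : 0 ≤ ∑ i ∈ R, q i := Finset.sum_nonneg fun i _ => hq i
    -- Only the entry `l / ω` of `c_l` is needed, because the sum runs over `T ∩ R` alone.
    have h5 := div_le_cCoef n ω τ l
    have h6 : (n.choose τ : ℝ) * (cCoef n ω τ l * piProb n ω τ l * ∑ i, q i) =
        ((n - ω).choose (τ - l) : ℝ) * (cCoef n ω τ l * (ω.choose l * ∑ i, q i)) := by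
      unfold piProb
      field_simp
    rw [h2, h6]
    gcongr
    exact (by positivity : (0 : ℝ) ≤ l / ω).trans h5
  · intro T hT
    obtain ⟨hT, hkT⟩ := Finset.mem_filter.1 hT
    have hTc := (Finset.mem_powersetCard.1 hT).2
    have h1 : (T ∩ R).card ≤ T.card := Finset.card_le_card Finset.inter_subset_left
    have h2 : (T ∩ R).card ≤ R.card := Finset.card_le_card Finset.inter_subset_right
    have h3 := Finset.card_union_add_card_inter T R
    have h4 := (T ∪ R).card_le_univ
    rw [Fintype.card_fin] at h4
    simp only [Finset.mem_Icc, kMin, kMax]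
    omega

/-- Expected maximum bound: if each `Φ T` is dominated by the Cauchy-Schwarz bound for one of the
sets `R j` of cardinality at most `ω`, the average of `Φ` is controlled by `betaThree`. -/
theorem sum_le_betaThree {m n ω τ : ℕ} (hω : 1 ≤ ω) (hωn : ω ≤ n) (hτ : 1 ≤ τ) (hτn : τ ≤ n)
    (R : Fin m → Finset (Fin n)) (hR : ∀ j, (R j).card ≤ ω) (q : Fin n → ℝ)
    (hq : ∀ i, 0 ≤ q i) (Φ : Finset (Fin n) → ℝ)
    (hΦ : ∀ T, ∃ j, Φ T ≤ (T ∩ R j).card * ∑ i ∈ T ∩ R j, q i) :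
    ∑ T ∈ Finset.univ.powersetCard τ, Φ T ≤
      n.choose τ * (τ / n * (betaThree m n ω τ * ∑ i, q i)) := by
  have hn' : (0 : ℝ) < n := by exact_mod_cast (by omega : 0 < n)
  have hτ' : (0 : ℝ) < τ := by exact_mod_cast hτ
  -- Supports are enlarged to exactly `ω` elements so that `|T ∩ R' j|` is hypergeometric with
  -- parameter `ω`.
  have hext : ∀ j, ∃ R' : Finset (Fin n), R j ⊆ R' ∧ R'.card = ω := fun j =>
    Finset.exists_superset_card_eq (hR j) (by simpa using hωn)
  choose R' hRR' hR' using hext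
  have hq0 : ∀ s : Finset (Fin n), 0 ≤ ∑ i ∈ s, q i := fun s => Finset.sum_nonneg fun i _ => hq i
  choose J hJ using hΦ
  let X : ℕ → Finset (Fin n) → Fin m → ℝ := fun k T j =>
    if k ≤ (T ∩ R' j).card then ∑ i ∈ T ∩ R' j, q i else 0
  have hX0 : ∀ k T j, 0 ≤ X k T j := fun k T j => by
    dsimp only [X]
    split_ifs
    · exact hq0 _
    · exact le_rfl
  have hlayer : ∀ T ∈ Finset.univ.powersetCard τ,
      Φ T ≤ ∑ k ∈ Finset.Icc 1 (kMax ω τ), X k T (J T) := by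
    intro T hT
    have hTc := (Finset.mem_powersetCard.1 hT).2
    have hsub : T ∩ R (J T) ⊆ T ∩ R' (J T) := Finset.inter_subset_inter_left (hRR' _)
    have h1 : (T ∩ R' (J T)).card ≤ kMax ω τ := le_min
      (hTc ▸ Finset.card_le_card Finset.inter_subset_left)
      (hR' (J T) ▸ Finset.card_le_card Finset.inter_subset_right)
    have h2 : ∑ k ∈ Finset.Icc 1 (kMax ω τ), X k T (J T) =
        (T ∩ R' (J T)).card * ∑ i ∈ T ∩ R' (J T), q i := by
      dsimp only [X]
      rw [← Finset.sum_filter, Finset.sum_const, nsmul_eq_mul]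
      congr 2
      have : (Finset.Icc 1 (kMax ω τ)).filter (fun k => k ≤ (T ∩ R' (J T)).card) =
          Finset.Icc 1 (T ∩ R' (J T)).card := by
        ext k
        simp only [Finset.mem_filter, Finset.mem_Icc]
        omega
      rw [this, Nat.card_Icc, Nat.add_sub_cancel]
    rw [h2]
    refine (hJ T).trans ?_
    have h3 : ((T ∩ R (J T)).card : ℝ) ≤ (T ∩ R' (J T)).card := by
      exact_mod_cast Finset.card_le_card hsub
    have h4 : ∑ i ∈ T ∩ R (J T), q i ≤ ∑ i ∈ T ∩ R' (J T), q i :=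
      Finset.sum_le_sum_of_subset_of_nonneg hsub fun i _ _ => hq i
    have := hq0 (T ∩ R (J T))
    gcongr
  refine (Finset.sum_le_sum hlayer).trans ?_
  rw [Finset.sum_comm]
  unfold betaThree
  rw [Finset.sum_mul, Finset.mul_sum, Finset.mul_sum]
  refine Finset.sum_le_sum fun k hk => ?_
  have hk1 := (Finset.mem_Icc.1 hk).1
  -- First bound for a layer: drop the indicator and enlarge `T ∩ R'` to `T`.
  have hall : ∑ T ∈ Finset.univ.powersetCard τ, X k T (J T) ≤
      n.choose τ * (τ / n * (1 * ∑ i, q i)) := by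
    have h1 := sum_powersetCard_sum (Finset.univ : Finset (Fin n)) τ q
    rw [Finset.card_univ, Fintype.card_fin] at h1
    have h2 : (n.choose τ : ℝ) * (τ / n * (1 * ∑ i, q i)) =
        ∑ T ∈ Finset.univ.powersetCard τ, ∑ i ∈ T, q i := by
      field_simp
      linarith
    rw [h2]
    refine Finset.sum_le_sum fun T _ => ?_
    dsimp only [X]
    split_ifs
    · exact Finset.sum_le_sum_of_subset_of_nonneg Finset.inter_subset_left fun i _ _ => hq i
    · exact hq0 _
  -- Second bound: the row `J T` depends on `T`, so sum over all `m` rows.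
  have hhyp : ∑ T ∈ Finset.univ.powersetCard τ, X k T (J T) ≤
      n.choose τ * (τ / n * ((m * n / τ * ∑ l ∈ Finset.Icc (max k (kMin n ω τ)) (kMax ω τ),
        cCoef n ω τ l * piProb n ω τ l) * ∑ i, q i)) := by
    calc ∑ T ∈ Finset.univ.powersetCard τ, X k T (J T)
        ≤ ∑ T ∈ Finset.univ.powersetCard τ, ∑ j, X k T j :=
          Finset.sum_le_sum fun T _ => Finset.single_le_sum (f := fun j => X k T j)
            (fun j _ => hX0 k T j) (Finset.mem_univ _)
      _ = ∑ j, ∑ T ∈ Finset.univ.powersetCard τ, X k T j := Finset.sum_comm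
      _ ≤ ∑ j : Fin m, n.choose τ * ((∑ l ∈ Finset.Icc (max k (kMin n ω τ)) (kMax ω τ),
            cCoef n ω τ l * piProb n ω τ l) * ∑ i, q i) :=
          Finset.sum_le_sum fun j _ => sum_inter_le hω hτn (R' j) (hR' j) q hq k hk1
      _ = _ := by
          rw [Finset.sum_const, Finset.card_univ, Fintype.card_fin, nsmul_eq_mul]
          field_simp
  rcases min_choice (1 : ℝ) (m * n / τ * ∑ l ∈ Finset.Icc (max k (kMin n ω τ)) (kMax ω τ),
      cCoef n ω τ l * piProb n ω τ l) with h | h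
  · rw [h]; exact hall
  · rw [h]; exact hhyp

/-! ### From second moments to the ESO. -/

/-- A second moment bound for the dual norm over subsets of cardinality `τ` yields an ESO. -/
theorem admitsESO_of_moment_bound {m n : ℕ} {N : Fin n → ℕ} {E : Type*} [NormedAddCommGroup E]
    [NormedSpace ℝ E] (L : (Fin m → ℝ) →ₗ[ℝ] E) (hinj : Function.Injective L) {p : ℝ}
    (hp : 0 < p) {v : Fin m → ℝ} (hdual : ∀ u, vDualNorm p v u = ‖L u‖)
    (hL : ∀ z u, z ⬝ᵥ u ≤ vNorm p v z * ‖L u‖)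
    (A : Matrix (Fin m) (Σ i : Fin n, Fin (N i)) ℝ) (hA : ∀ i, colBlock A i ≠ 0)
    (B : (i : Fin n) → Matrix (Fin (N i)) (Fin (N i)) ℝ) (hB : ∀ i, (B i).PosDef)
    {Q : Set (Fin m → ℝ)} (hne : Q.Nonempty) (hQ : IsCompact Q) (hconv : Convex ℝ Q)
    {g d : (Fin m → ℝ) → ℝ} (hg : ConvexOn ℝ Set.univ g) {σ μ : ℝ} (hσ : 0 < σ) (hμ : 0 < μ)
    (hd : IsProxFunction p v Q σ d)
    {Om : Type*} [MeasurableSpace Om] (P : Measure Om) [IsProbabilityMeasure P]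
    {τ : ℕ} (hτ : 1 ≤ τ) (S : Om → Finset (Fin n)) (hS : IsTauNice P τ S) {β : ℝ} (hβ : 0 < β)
    (hmom : ∀ h : BlockSpace N,
      ∑ T ∈ Finset.univ.powersetCard τ, ‖L (∑ i ∈ T, colBlock A i *ᵥ block h i)‖ ^ 2 ≤
        n.choose τ * (τ / n * (β * ∑ i, ‖L (colBlock A i *ᵥ block h i)‖ ^ 2))) :
    AdmitsESO P S B (smoothed A Q g d μ) (β / (μ * σ)) (wStar p v A B) := by
  have hgrad := exists_gradient_smoothed L hp v hL A hne hQ hconv hg hσ hμ hd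
  refine ⟨fun x => ?_, by positivity, wStar_pos L hinj hdual A hA B hB, fun x h => ?_⟩
  · obtain ⟨y, hy, -⟩ := hgrad x
    exact hy.differentiableAt
  obtain ⟨y, hy, hub⟩ := hgrad x
  rw [hy.gradient]
  have hτn := hS.le
  have hch : (0 : ℝ) < n.choose τ := by exact_mod_cast Nat.choose_pos hτn
  have hn : (0 : ℝ) < n := by exact_mod_cast (by omega : 0 < n)
  have hcard : ∫ s, ((S s).card : ℝ) ∂P = τ := by
    rw [hS.integral_eq fun T => (T.card : ℝ), Finset.sum_congr rfl (g := fun _ => (τ : ℝ))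
      fun T hT => by rw [(Finset.mem_powersetCard.1 hT).2]]
    simp
    field_simp
  rw [hcard, hS.integral_eq fun T => smoothed A Q g d μ (x + restrictBlocks h T),
    div_le_iff₀ hch]
  have hlin := sum_powersetCard_sum Finset.univ τ fun i => block y i ⬝ᵥ block h i
  rw [Finset.card_univ, Fintype.card_fin, ← inner_eq_sum_block] at hlin
  have hlin' : ∑ T ∈ Finset.univ.powersetCard τ, ∑ i ∈ T, block y i ⬝ᵥ block h i =
      n.choose τ * (τ / n * inner ℝ y h) := by
    field_simp
    linarith
  have hw : ∑ i, ‖L (colBlock A i *ᵥ block h i)‖ ^ 2 ≤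
      ∑ i, wStar p v A B i * ((B i *ᵥ block h i) ⬝ᵥ block h i) :=
    Finset.sum_le_sum fun i _ => norm_sq_colBlock_le L hdual A B hB i (block h i)
  calc ∑ T ∈ Finset.univ.powersetCard τ, smoothed A Q g d μ (x + restrictBlocks h T)
      ≤ ∑ T ∈ Finset.univ.powersetCard τ, (smoothed A Q g d μ x +
          ∑ i ∈ T, block y i ⬝ᵥ block h i +
          ‖L (∑ i ∈ T, colBlock A i *ᵥ block h i)‖ ^ 2 / (2 * (μ * σ))) := by
        refine Finset.sum_le_sum fun T _ => ?_
        rw [← inner_restrictBlocks, ← mulVec_restrictBlocks]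
        exact hub _
    _ = n.choose τ * smoothed A Q g d μ x + n.choose τ * (τ / n * inner ℝ y h) +
          (∑ T ∈ Finset.univ.powersetCard τ,
            ‖L (∑ i ∈ T, colBlock A i *ᵥ block h i)‖ ^ 2) / (2 * (μ * σ)) := by
        rw [Finset.sum_add_distrib, Finset.sum_add_distrib, hlin', Finset.sum_div,
          Finset.sum_const, Finset.card_powersetCard, Finset.card_univ, Fintype.card_fin,
          nsmul_eq_mul]
    _ ≤ n.choose τ * smoothed A Q g d μ x + n.choose τ * (τ / n * inner ℝ y h) +
          n.choose τ * (τ / n * (β *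
            ∑ i, wStar p v A B i * ((B i *ᵥ block h i) ⬝ᵥ block h i))) / (2 * (μ * σ)) := by
        gcongr
        refine (hmom h).trans ?_
        gcongr
    _ = _ := by
        field_simp
        ring

lemma colBlock_mulVec_eq_zero {m n : ℕ} {N : Fin n → ℕ}
    (A : Matrix (Fin m) (Σ i : Fin n, Fin (N i)) ℝ) (h : BlockSpace N) (j : Fin m) (i : Fin n)
    (hi : i ∉ rowBlocks A j) : (colBlock A i *ᵥ block h i) j = 0 := by
  have : colBlock A i j = 0 := by simpa [rowBlocks] using hi
  simp [mulVec, this]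

/-- The squared norm is a sum over rows, so the scalar bound applies row by row. -/
theorem moment_bound_two {m n : ℕ} {N : Fin n → ℕ} {ω τ : ℕ} (hτ : 1 ≤ τ) (hτn : τ ≤ n)
    (A : Matrix (Fin m) (Σ i : Fin n, Fin (N i)) ℝ) (hω : ∀ j, (rowBlocks A j).ncard ≤ ω)
    (v : Fin m → ℝ) (h : BlockSpace N) :
    ∑ T ∈ Finset.univ.powersetCard τ,
        ‖divEuclid v (∑ i ∈ T, colBlock A i *ᵥ block h i)‖ ^ 2 ≤
      n.choose τ * (τ / n * (betaTwo n ω τ *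
        ∑ i, ‖divEuclid v (colBlock A i *ᵥ block h i)‖ ^ 2)) := by
  classical
  have hsq : ∀ z, ‖divEuclid v z‖ ^ 2 = ∑ j, (z j / v j) ^ 2 := fun z => by
    rw [norm_divEuclid, Real.sq_sqrt (Finset.sum_nonneg fun j _ => sq_nonneg _)]
  simp_rw [hsq, Finset.sum_apply, Finset.sum_div]
  rw [Finset.sum_comm, Finset.sum_comm (s := (Finset.univ : Finset (Fin n))), Finset.mul_sum,
    Finset.mul_sum, Finset.mul_sum]
  refine Finset.sum_le_sum fun j _ => ?_
  refine sum_sq_sum_le_betaTwo hτ hτn (rowBlocks A j).toFinset ?_ _ fun i hi => ?_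
  · rw [← Set.ncard_eq_toFinset_card']
    exact hω j
  · rw [colBlock_mulVec_eq_zero A h j i (by simpa using hi), zero_div]

/-- The squared norm is that of a single maximizing row, where only blocks in `T ∩ rowBlocks A j`
contribute to Cauchy-Schwarz. -/
theorem moment_bound_one {m n : ℕ} {N : Fin n → ℕ} {ω τ : ℕ} (hm : 1 ≤ m) (hω1 : 1 ≤ ω)
    (hωn : ω ≤ n) (hτ : 1 ≤ τ) (hτn : τ ≤ n)
    (A : Matrix (Fin m) (Σ i : Fin n, Fin (N i)) ℝ) (hω : ∀ j, (rowBlocks A j).ncard ≤ ω)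
    (v : Fin m → ℝ) (h : BlockSpace N) :
    ∑ T ∈ Finset.univ.powersetCard τ,
        ‖divSup v (∑ i ∈ T, colBlock A i *ᵥ block h i)‖ ^ 2 ≤
      n.choose τ * (τ / n * (betaThree m n ω τ *
        ∑ i, ‖divSup v (colBlock A i *ᵥ block h i)‖ ^ 2)) := by
  classical
  have : Nonempty (Fin m) := ⟨⟨0, hm⟩⟩
  refine sum_le_betaThree hω1 hωn hτ hτn (fun j => (rowBlocks A j).toFinset) (fun j => ?_) _
    (fun i => sq_nonneg _) _ fun T => ?_
  · rw [← Set.ncard_eq_toFinset_card']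
    exact hω j
  · obtain ⟨j, hj⟩ := exists_norm_divSup_eq v (∑ i ∈ T, colBlock A i *ᵥ block h i)
    refine ⟨j, ?_⟩
    rw [hj, Real.norm_eq_abs, sq_abs, map_sum, Finset.sum_apply,
      ← Finset.sum_subset (Finset.inter_subset_left (s₂ := (rowBlocks A j).toFinset))]
    · refine sq_sum_le_card_mul_sum_sq.trans ?_
      refine mul_le_mul_of_nonneg_left (Finset.sum_le_sum fun i _ => ?_) (Nat.cast_nonneg _)
      rw [← sq_abs, ← Real.norm_eq_abs]
      gcongr
      exact norm_le_pi_norm _ j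
    · intro i hi hij
      have : i ∉ rowBlocks A j := fun hc => hij (by simpa [hi] using hc)
      simp [divSup, colBlock_mulVec_eq_zero A h j i this]

end NesterovESO

theorem mainTheorem3 {m n : ℕ} {N : Fin n → ℕ}
    (A : Matrix (Fin m) (Σ i : Fin n, Fin (N i)) ℝ)
    (hA : ∀ i, NesterovESO.colBlock A i ≠ 0)
    (B : (i : Fin n) → Matrix (Fin (N i)) (Fin (N i)) ℝ)
    (hB : ∀ i, (B i).PosDef)
    (Q : Set (Fin m → ℝ)) (g : (Fin m → ℝ) → ℝ) (ω : ℕ)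
    (f : NesterovESO.BlockSpace N → ℝ)
    (hf : NesterovESO.IsNesterovSeparable A Q g ω f)
    (p : ℝ) (v : Fin m → ℝ) (hv : ∀ j, 0 < v j)
    (σ : ℝ) (hσ : 0 < σ) (d : (Fin m → ℝ) → ℝ)
    (hd : NesterovESO.IsProxFunction p v Q σ d)
    (μ : ℝ) (hμ : 0 < μ)
    {Om : Type*} [MeasurableSpace Om] (P : MeasureTheory.Measure Om)
    [MeasureTheory.IsProbabilityMeasure P]
    (τ : ℕ) (hτ : 1 ≤ τ) (S : Om → Finset (Fin n))
    (hS : NesterovESO.IsTauNice P τ S) :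
    (p = 2 →
      NesterovESO.AdmitsESO P S B (NesterovESO.smoothed A Q g d μ)
        (NesterovESO.betaTwo n ω τ / (μ * σ)) (NesterovESO.wStar p v A B)) ∧
    (p = 1 → ω ≤ n →
      NesterovESO.AdmitsESO P S B (NesterovESO.smoothed A Q g d μ)
        (NesterovESO.betaThree m n ω τ / (μ * σ)) (NesterovESO.wStar p v A B)) := by
  obtain ⟨hne, hQ, hconv, hg, -, hω⟩ := hf
  have hτn := hS.le
  -- Since `1 ≤ τ ≤ n` there is a first block; its nonzero row yields `m ≥ 1` and `ω ≥ 1`, needed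
  -- for `β' > 0`.
  obtain ⟨j, hj⟩ := Function.ne_iff.1 (hA ⟨0, by omega⟩)
  have hm : 1 ≤ m := by have := j.2; omega
  have hω1 : 1 ≤ ω := by
    refine le_trans ?_ (hω j)
    exact (Set.ncard_pos).2 ⟨_, hj⟩
  constructor
  · rintro rfl
    exact NesterovESO.admitsESO_of_moment_bound (NesterovESO.divEuclid v)
      (NesterovESO.divEuclid_injective hv) two_pos (NesterovESO.vDualNorm_two hv)
      (NesterovESO.dotProduct_le_vNorm_two hv) A hA B hB hne hQ hconv hg hσ hμ hd P hτ S hS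
      (NesterovESO.betaTwo_pos hω1 hτ) (NesterovESO.moment_bound_two hτ hτn A hω v)
  · rintro rfl hωn
    exact NesterovESO.admitsESO_of_moment_bound (NesterovESO.divSup v)
      (NesterovESO.divSup_injective hv) one_pos (NesterovESO.vDualNorm_one hv)
      (NesterovESO.dotProduct_le_vNorm_one hv) A hA B hB hne hQ hconv hg hσ hμ hd P hτ S hS
      (NesterovESO.betaThree_pos hm hω1 hωn hτ hτn)
      (NesterovESO.moment_bound_one hm hω1 hωn hτ hτn A hω v)
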